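/- Let $s,t,k\ge 0$ be integers and $a,b\in\mathbb{R}$. Let $A$ be any real $s\times k$ matrix and $B$ any real $t\times k$ matrix. Let $X_{s,k}$ and $X_{t,k}$ be independent random matrices of sizes $s\times k$ and $t\times k$, each having independent, identically distributed entries that are symmetric real random variables ($Y$ and $-Y$ have the same law) with variance $1$ and finite moments of all orders. For real matrices $M$ of size $s\times k$ and $N$ of size $t\times k$, let $q_{M,N}\in\mathbb{R}[x,y,z]$ be the polynomial \[ q_{M,N}(x,y,z)=y^s z^t\,p_{M,N}(x,1/y,1/z),\qquad p_{M,N}(x,y,z)=\det\!\left(xI_k+yM^{T}M+zN^{T}N\right), \] so that $q_{M,N}(x,y,z)=y^sz^t\det\!\left(xI_k+\tfrac1y M^TM+\tfrac1z N^TN\right)$ whenever $y,z\neq0$. Then every coefficient of the random polynomial $q_{A+aX_{s,k},\,B+bX_{t,k}}$ is integrable, and \[ \mathbb{E}\left[q_{A+aX_{s,k},\,B+bX_{t,k}}(x,y,z)\right]=e^{a^2\partial_x\partial_y+b^2\partial_x\partial_z}\left[q_{A,B}(x,y,z)\right] \] as polynomials in $x,y,z$, where the expectation is taken coefficientwise and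 \[ e^{a^2\partial_x\partial_y+b^2\partial_x\partial_z}=\sum_{n\ge0}\frac{1}{n!}\left(a^2\partial_x\partial_y+b^2\partial_x\partial_z\right)^n, \] of which only finitely many terms are nonzero on a given polynomial. -/

import Mathlib

open MeasureTheory ProbabilityTheory

noncomputable section

/-- Real polynomials in the three variables `x = X 0`, `y = X 1`, `z = X 2`. -/
abbrev PolyXYZ : Type := MvPolynomial (Fin 3) ℝ

/-- The generalized characteristic polynomial
`p_{A,B}(x,y,z) = det (x I + y Aᵀ A + z Bᵀ B)`. -/
def genCharPoly {s t k : ℕ} (A : Matrix (Fin s) (Fin k) ℝ) (B : Matrix (Fin t) (Fin k) ℝ) :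
    PolyXYZ :=
  ((MvPolynomial.X 0 : PolyXYZ) • (1 : Matrix (Fin k) (Fin k) PolyXYZ)
    + (MvPolynomial.X 1 : PolyXYZ) • (A.transpose * A).map (fun c => (MvPolynomial.C c : PolyXYZ))
    + (MvPolynomial.X 2 : PolyXYZ) •
        (B.transpose * B).map (fun c => (MvPolynomial.C c : PolyXYZ))).det

/-- The transformed polynomial `q_{A,B}(x,y,z) = y^s z^t p_{A,B}(x,1/y,1/z)`: every monomial
`x^i y^j z^l` of `p_{A,B}` is replaced by `x^i y^(s-j) z^(t-l)`. The subtractions never truncate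
(`genCharPoly_exponents_le`), and `eval_transCharPoly` gives
`q_{A,B}(x,y,z) = y^s z^t det (x I + Aᵀ A / y + Bᵀ B / z)` for `y, z ≠ 0`. -/
def transCharPoly {s t k : ℕ} (A : Matrix (Fin s) (Fin k) ℝ) (B : Matrix (Fin t) (Fin k) ℝ) :
    PolyXYZ :=
  ∑ m ∈ (genCharPoly A B).support,
    MvPolynomial.C ((genCharPoly A B).coeff m) *
      (MvPolynomial.X 0 ^ m 0 * MvPolynomial.X 1 ^ (s - m 1) * MvPolynomial.X 2 ^ (t - m 2))

theorem degreeOf_det_add_le {n k : ℕ} (v : Fin 3) (N : Matrix (Fin k) (Fin k) PolyXYZ)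
    (hN : ∀ i j, (N i j).degreeOf v = 0) (M : Matrix (Fin n) (Fin k) ℝ) :
    (N + (MvPolynomial.X v : PolyXYZ) •
      (M.transpose * M).map (fun c => (MvPolynomial.C c : PolyXYZ))).det.degreeOf v ≤ n := by
  classical
  set U : Matrix (Fin n) (Fin k) PolyXYZ := M.map (fun c => (MvPolynomial.C c : PolyXYZ)) with hU
  have h1 : (N + (MvPolynomial.X v : PolyXYZ) •
      (M.transpose * M).map (fun c => (MvPolynomial.C c : PolyXYZ)))
      = N - (-U.transpose) * ((MvPolynomial.X v : PolyXYZ) • U) := by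
    ext1 i j
    simp [hU, Matrix.mul_apply, Finset.mul_sum]
  rw [h1, ← Matrix.det_fromBlocks_one₂₂, Matrix.det_apply]
  refine (MvPolynomial.degreeOf_sum_le _ _ _).trans (Finset.sup_le fun σ _ => ?_)
  set W := Matrix.fromBlocks N (-U.transpose) ((MvPolynomial.X v : PolyXYZ) • U) 1 with hW
  have hentry : ∀ i j, (W i j).degreeOf v ≤ (if i.isRight then 1 else 0) := by
    rintro (i | i) (j | j)
    · simp [hW, hN]
    · have : -U.transpose i j = MvPolynomial.C (-(M j i)) := by simp [hU]
      simp only [hW, Matrix.fromBlocks_apply₁₂, Matrix.neg_apply, this, MvPolynomial.degreeOf_C]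
      simp
    · simp only [hW, Matrix.fromBlocks_apply₂₁, Matrix.smul_apply, smul_eq_mul, hU,
        Matrix.map_apply]
      refine (MvPolynomial.degreeOf_mul_le _ _ _).trans ?_
      simp
    · simp only [hW, Matrix.fromBlocks_apply₂₂, Matrix.one_apply]
      split_ifs <;> simp
  have hs : (Equiv.Perm.sign σ • ∏ i, W (σ i) i).degreeOf v ≤ (∏ i, W (σ i) i).degreeOf v := by
    rcases Int.units_eq_one_or (Equiv.Perm.sign σ) with h | h <;> rw [h]
    · simp
    · have : ((-1 : ℤˣ) • ∏ i, W (σ i) i) = MvPolynomial.C (-1) * ∏ i, W (σ i) i := by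
        simp [Units.smul_def]
      rw [this]
      exact MvPolynomial.degreeOf_C_mul_le _ _ _
  refine hs.trans ((MvPolynomial.degreeOf_prod_le _ _ _).trans ?_)
  refine (Finset.sum_le_sum fun i _ => hentry (σ i) i).trans ?_
  rw [Equiv.sum_comp σ (fun i : Fin k ⊕ Fin n => if i.isRight then 1 else 0), Fintype.sum_sum_type]
  simp

theorem genCharPoly_exponents_le {s t k : ℕ} (A : Matrix (Fin s) (Fin k) ℝ)
    (B : Matrix (Fin t) (Fin k) ℝ) {m : Fin 3 →₀ ℕ} (hm : m ∈ (genCharPoly A B).support) :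
    m 1 ≤ s ∧ m 2 ≤ t := by
  have hx : ∀ (v : Fin 3), v ≠ 0 → ∀ i j : Fin k,
      (((MvPolynomial.X 0 : PolyXYZ) • (1 : Matrix (Fin k) (Fin k) PolyXYZ)) i j).degreeOf v
        = 0 := by
    intro v hv i j
    by_cases h : i = j <;> simp [h, MvPolynomial.degreeOf_X, hv]
  have hy : ∀ (v w : Fin 3), v ≠ w → ∀ (P : Matrix (Fin k) (Fin k) ℝ) (i j : Fin k),
      (((MvPolynomial.X w : PolyXYZ) •
        P.map (fun c => (MvPolynomial.C c : PolyXYZ))) i j).degreeOf v = 0 := by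
    intro v w hv P i j
    refine Nat.le_zero.1 ?_
    simp only [Matrix.smul_apply, smul_eq_mul, Matrix.map_apply]
    refine (MvPolynomial.degreeOf_mul_le _ _ _).trans ?_
    simp [MvPolynomial.degreeOf_X, hv]
  constructor
  · refine (MvPolynomial.monomial_le_degreeOf 1 hm).trans ?_
    rw [genCharPoly, add_right_comm]
    refine degreeOf_det_add_le 1 _ (fun i j => Nat.le_zero.1 ?_) A
    rw [Matrix.add_apply]
    refine (MvPolynomial.degreeOf_add_le _ _ _).trans ?_
    rw [hx 1 (by decide), hy 1 2 (by decide)]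
    simp
  · refine (MvPolynomial.monomial_le_degreeOf 2 hm).trans ?_
    rw [genCharPoly]
    refine degreeOf_det_add_le 2 _ (fun i j => Nat.le_zero.1 ?_) B
    rw [Matrix.add_apply]
    refine (MvPolynomial.degreeOf_add_le _ _ _).trans ?_
    rw [hx 2 (by decide), hy 2 1 (by decide)]
    simp

theorem eval_genCharPoly {s t k : ℕ} (A : Matrix (Fin s) (Fin k) ℝ)
    (B : Matrix (Fin t) (Fin k) ℝ) (x y z : ℝ) :
    MvPolynomial.eval ![x, y, z] (genCharPoly A B)
      = (x • (1 : Matrix (Fin k) (Fin k) ℝ) + y • (A.transpose * A)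
          + z • (B.transpose * B)).det := by
  rw [genCharPoly, RingHom.map_det]
  congr 1
  ext i j
  by_cases h : i = j <;> simp [h, Matrix.mul_apply]

theorem eval_transCharPoly {s t k : ℕ} (A : Matrix (Fin s) (Fin k) ℝ)
    (B : Matrix (Fin t) (Fin k) ℝ) (x y z : ℝ) (hy : y ≠ 0) (hz : z ≠ 0) :
    MvPolynomial.eval ![x, y, z] (transCharPoly A B)
      = y ^ s * z ^ t * (x • (1 : Matrix (Fin k) (Fin k) ℝ) + y⁻¹ • (A.transpose * A)
          + z⁻¹ • (B.transpose * B)).det := by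
  rw [← eval_genCharPoly, MvPolynomial.eval_eq' _ (genCharPoly A B), Finset.mul_sum,
    transCharPoly, map_sum]
  refine Finset.sum_congr rfl fun m hm => ?_
  obtain ⟨h1, h2⟩ := genCharPoly_exponents_le A B hm
  simp [Fin.prod_univ_three, pow_sub₀ _ hy h1, pow_sub₀ _ hz h2]
  ring

/-- The operator `α ∂_x ∂_y + β ∂_x ∂_z` on polynomials in `x, y, z`. -/
def mixedDiffOp (α β : ℝ) : PolyXYZ →ₗ[ℝ] PolyXYZ :=
  α • ((MvPolynomial.pderiv 0 : Derivation ℝ PolyXYZ PolyXYZ).toLinearMap ∘ₗ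
      (MvPolynomial.pderiv 1 : Derivation ℝ PolyXYZ PolyXYZ).toLinearMap)
    + β • ((MvPolynomial.pderiv 0 : Derivation ℝ PolyXYZ PolyXYZ).toLinearMap ∘ₗ
      (MvPolynomial.pderiv 2 : Derivation ℝ PolyXYZ PolyXYZ).toLinearMap)

/-- `e^L [p] = ∑_{n ≥ 0} L^n [p] / n!`, for a linear operator `L` on polynomials such that only
finitely many terms are nonzero (`mixedDiffOp_finite_support` for the operator used here). -/
def expApply (L : PolyXYZ →ₗ[ℝ] PolyXYZ) (p : PolyXYZ) : PolyXYZ :=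
  ∑ᶠ n : ℕ, ((n.factorial : ℝ)⁻¹) • (L ^ n) p

theorem mixedDiffOp_pow_eq_zero (α β : ℝ) (n : ℕ) (p : PolyXYZ)
    (hp : ∀ m : Fin 3 →₀ ℕ, n ≤ m 0 → p.coeff m = 0) : (mixedDiffOp α β ^ n) p = 0 := by
  induction n generalizing p with
  | zero => ext m; simpa using hp m (Nat.zero_le _)
  | succ n ih =>
    rw [pow_succ, Module.End.mul_apply]
    refine ih _ fun m hm => ?_
    have key : ∀ v : Fin 3, v ≠ 0 →
        (MvPolynomial.pderiv 0 (MvPolynomial.pderiv v p)).coeff m = 0 := by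
      intro v hv
      rw [MvPolynomial.coeff_pderiv, MvPolynomial.coeff_pderiv, hp]
      · simp
      · simp [hv]; omega
    simp [mixedDiffOp, key 1 (by decide), key 2 (by decide)]

theorem mixedDiffOp_finite_support (α β : ℝ) (p : PolyXYZ) :
    (Function.support fun n : ℕ =>
      ((n.factorial : ℝ)⁻¹) • (mixedDiffOp α β ^ n) p).Finite := by
  refine (Set.finite_Iic (p.degreeOf 0)).subset fun n hn => ?_
  by_contra h
  refine hn ?_
  have : (mixedDiffOp α β ^ n) p = 0 := by
    refine mixedDiffOp_pow_eq_zero α β n p fun m hm => ?_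
    by_contra hc
    have := MvPolynomial.monomial_le_degreeOf 0 (MvPolynomial.mem_support_iff.2 hc)
    simp only [Set.mem_Iic] at h
    omega
  simp [this]

/-- `X` is a random `m × n` matrix whose entries are independent, identically distributed,
symmetric real random variables with variance `1` and finite moments of all orders. -/
structure IsStdRandomMatrix {Ω : Type*} [MeasurableSpace Ω] (μ : Measure Ω) {m n : ℕ}
    (X : Ω → Matrix (Fin m) (Fin n) ℝ) : Prop where
  measurable_entry : ∀ i j, Measurable fun ω => X ω i j
  indep : iIndepFun (fun (e : Fin m × Fin n) ω => X ω e.1 e.2) μ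
  identDistrib : ∀ i j i' j', IdentDistrib (fun ω => X ω i j) (fun ω => X ω i' j') μ μ
  symmetric : ∀ i j, IdentDistrib (fun ω => X ω i j) (fun ω => - X ω i j) μ μ
  variance_eq_one : ∀ i j, variance (fun ω => X ω i j) μ = 1
  finite_moments : ∀ i j, ∀ r : ℕ, Integrable (fun ω => |X ω i j| ^ r) μ

/-- The random polynomial `P` has expectation the polynomial `R`: each coefficient of `P` is
integrable and its expectation is the corresponding coefficient of `R`. -/
def HasPolyExpectation {Ω : Type*} [MeasurableSpace Ω] (μ : Measure Ω) (P : Ω → PolyXYZ)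
    (R : PolyXYZ) : Prop :=
  ∀ m : Fin 3 →₀ ℕ, Integrable (fun ω => (P ω).coeff m) μ ∧ ∫ ω, (P ω).coeff m ∂μ = R.coeff m

end

/-!
The polynomial `q_{A,B}(x,y,z)` is the determinant of the block matrix
`[[x I, Aᵀ, Bᵀ], [-A, y I, 0], [-B, 0, z I]]` (Schur complement, `rename_det_skewBlock`). The
variables are polarised: `diag(X) + M` carries one variable `X_i` for every diagonal place, and
`M = skewBlock A B` is skew-symmetric. Changing one entry of `A` or `B` by `u` changes `M` by
`u (E_pq - E_qp)`, where `p` is the column index and `q` the row index of the entry. The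
determinant is then quadratic in `u`, and its second order coefficient is the principal minor
without the rows and columns `p, q`, which is `∂_p ∂_q det` since the determinant has degree at
most one in each variable (`det_diagVarAdd_add_smul_skewUnit`).

Averaging over an independent entry `u = c U` with mean `0` and variance `1` therefore applies the
operator `1 + c² ∂_p ∂_q`, which is `e^(c² ∂_p ∂_q)` on the determinant because `∂_p²` kills it.
Averaging over the entries one at a time and multiplying commuting exponentials
(`HasExp.add_of_sq_zero`) gives the exponential of the sum of all `c² ∂_p ∂_q`
(`exists_hasExp_expectation`). Identifying the variables within each block turns this sum into
`a² ∂_x ∂_y + b² ∂_x ∂_z` (`rename_sum_pderivTwo`). Expectations are handled through arbitrary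
linear functionals of the polynomial, so that the identification of variables commutes with them.
-/

noncomputable section

/-! ### Exponentials of locally nilpotent operators -/

/-- `HasExp L v w` says that the powers of the linear operator `L` eventually kill the vector `v`
and that the resulting finite sum `∑ Lⁿ v / n!` is `w`, i.e. `e^L v = w`. -/
def HasExp {V : Type*} [AddCommGroup V] [Module ℝ V] (L : Module.End ℝ V) (v w : V) : Prop :=
  ∃ N : ℕ, (∀ n, N ≤ n → (L ^ n) v = 0) ∧
    ∑ n ∈ Finset.range N, ((n.factorial : ℝ)⁻¹) • (L ^ n) v = w

namespace HasExp

variable {V W : Type*} [AddCommGroup V] [Module ℝ V] [AddCommGroup W] [Module ℝ W]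

theorem exp_zero (v : V) : HasExp 0 v v :=
  ⟨1, fun n hn => by rw [zero_pow (by omega)]; rfl, by simp⟩

theorem sum_range_eq {L : Module.End ℝ V} {v : V} {N N' : ℕ}
    (h : ∀ n, N ≤ n → (L ^ n) v = 0) (hN : N ≤ N') :
    ∑ n ∈ Finset.range N', ((n.factorial : ℝ)⁻¹) • (L ^ n) v
      = ∑ n ∈ Finset.range N, ((n.factorial : ℝ)⁻¹) • (L ^ n) v := by
  refine (Finset.sum_subset (Finset.range_mono hN) fun n _ hn => ?_).symm
  rw [h n (by simpa using hn), smul_zero]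

/-- Exponentials are transported by linear maps that intertwine the operators. -/
theorem map {L : Module.End ℝ V} {L' : Module.End ℝ W} {v w : V} (h : HasExp L v w)
    (φ : V →ₗ[ℝ] W) (hφ : ∀ u, φ (L u) = L' (φ u)) : HasExp L' (φ v) (φ w) := by
  have hpow : ∀ n : ℕ, (L' ^ n) (φ v) = φ ((L ^ n) v) := by
    intro n
    induction n with
    | zero => rfl
    | succ n ih => rw [pow_succ', pow_succ', Module.End.mul_apply, ih, Module.End.mul_apply, hφ]
  obtain ⟨N, hN, rfl⟩ := h
  refine ⟨N, fun n hn => by rw [hpow, hN n hn, map_zero], ?_⟩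
  simp_rw [map_sum, map_smul, hpow]

/-- If `D` commutes with `L` and `D² v = 0`, then `e^(L + D) v = e^L v + e^L D v`. -/
theorem add_of_sq_zero {L D : Module.End ℝ V} {v w w' : V} (hLD : Commute L D)
    (hD : D (D v) = 0) (h : HasExp L v w) (h' : HasExp L (D v) w') :
    HasExp (L + D) v (w + w') := by
  have hpow : ∀ n : ℕ, ((L + D) ^ (n + 1)) v
      = (L ^ (n + 1)) v + ((n + 1 : ℕ) : ℝ) • (L ^ n) (D v) := by
    intro n
    induction n with
    | zero => simp
    | succ n ih =>
      have hc : D ((L ^ (n + 1)) v) = (L ^ (n + 1)) (D v) :=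
        (LinearMap.congr_fun (hLD.pow_left (n + 1)).eq v).symm
      have hc' : D ((L ^ n) (D v)) = 0 := by
        rw [show D ((L ^ n) (D v)) = (L ^ n) (D (D v)) from
          (LinearMap.congr_fun (hLD.pow_left n).eq (D v)).symm, hD, map_zero]
      rw [pow_succ', Module.End.mul_apply, ih, LinearMap.add_apply, map_add, map_add, map_smul,
        map_smul, hc, hc', pow_succ' L (n + 1), Module.End.mul_apply, smul_zero, add_zero,
        pow_succ' L n, Module.End.mul_apply, Module.End.mul_apply]
      push_cast
      module
  obtain ⟨N, hN, rfl⟩ := h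
  obtain ⟨N', hN', rfl⟩ := h'
  refine ⟨max N N' + 1, fun n hn => ?_, ?_⟩
  · obtain ⟨m, rfl⟩ : ∃ m, n = m + 1 := ⟨n - 1, by omega⟩
    rw [hpow, hN _ (by omega), hN' _ (by omega), smul_zero, add_zero]
  · rw [← sum_range_eq hN (show N ≤ max N N' + 1 by omega),
      ← sum_range_eq hN' (show N' ≤ max N N' by omega), Finset.sum_range_succ',
      Finset.sum_range_succ' _ (max N N'),
      add_right_comm, ← Finset.sum_add_distrib]
    congr 1
    refine Finset.sum_congr rfl fun n _ => ?_
    rw [hpow, smul_add, smul_smul, Nat.factorial_succ]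
    congr 2
    have : (n.factorial : ℝ) ≠ 0 := by positivity
    push_cast
    field_simp

theorem expApply_eq {L : PolyXYZ →ₗ[ℝ] PolyXYZ} {p q : PolyXYZ} (h : HasExp L p q) :
    expApply L p = q := by
  obtain ⟨N, hN, rfl⟩ := h
  refine finsum_eq_sum_of_support_subset _ fun n hn => ?_
  by_contra hc
  exact hn (by simp [hN n (by simpa using hc)])

end HasExp

/-! ### Derivatives of determinants -/

section Derivation

variable {A ι : Type*} [CommRing A] [Algebra ℝ A] [Fintype ι] [DecidableEq ι]

theorem derivation_det_eq_zero (D : Derivation ℝ A A) (N : Matrix ι ι A)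
    (h : ∀ i j, D (N i j) = 0) : D N.det = 0 := by
  have hprod : ∀ (s : Finset ι) (f : ι → A), (∀ i, D (f i) = 0) → D (∏ i ∈ s, f i) = 0 := by
    intro s f hf
    induction s using Finset.induction_on with
    | empty => simp
    | insert i s hi ih => simp [Finset.prod_insert hi, hf, ih]
  rw [Matrix.det_apply, map_sum]
  refine Finset.sum_eq_zero fun σ _ => ?_
  rw [Units.smul_def, map_zsmul, hprod _ _ fun i => h _ _, smul_zero]

/-- A derivation that kills all rows of `N` but the row `p` acts on `det N` through that row. -/
theorem derivation_det_eq_det_updateRow (D : Derivation ℝ A A) (N : Matrix ι ι A) (p : ι)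
    (h : ∀ i, i ≠ p → ∀ j, D (N i j) = 0) :
    D N.det = (N.updateRow p fun j => D (N p j)).det := by
  have hrow : ∀ w : ι → A, (N.updateRow p w).det = ∑ j, w j * N.adjugate j p := by
    intro w
    rw [Matrix.det_eq_sum_mul_adjugate_row _ p]
    simp [Matrix.adjugate_apply]
  have hadj : ∀ j, D (N.adjugate j p) = 0 := by
    intro j
    rw [Matrix.adjugate_apply]
    refine derivation_det_eq_zero D _ fun i l => ?_
    by_cases hi : i = p
    · subst hi
      by_cases hl : l = j
      · subst hl; simp
      · simp [hl]
    · simpa [Matrix.updateRow_ne hi] using h i hi l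
  rw [hrow, Matrix.det_eq_sum_mul_adjugate_row N p, map_sum]
  refine Finset.sum_congr rfl fun j _ => ?_
  rw [Derivation.leibniz, hadj, smul_zero, zero_add, smul_eq_mul, mul_comm]

end Derivation

section CharMatrix

variable {ι : Type*}

theorem pderiv_pderiv_comm (i j : ι) (f : MvPolynomial ι ℝ) :
    MvPolynomial.pderiv i (MvPolynomial.pderiv j f)
      = MvPolynomial.pderiv j (MvPolynomial.pderiv i f) := by
  classical
  by_cases hij : i = j
  · rw [hij]
  ext m
  simp only [MvPolynomial.coeff_pderiv, Finsupp.coe_add, Pi.add_apply, Finsupp.single_apply, hij,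
    Ne.symm hij, if_false]
  rw [add_right_comm m]
  ring_nf

/-- The operator `∂_i ∂_j` on real polynomials in the variables `ι`. -/
def pderivTwo (i j : ι) : Module.End ℝ (MvPolynomial ι ℝ) :=
  (MvPolynomial.pderiv i).toLinearMap ∘ₗ (MvPolynomial.pderiv j).toLinearMap

theorem pderivTwo_apply (i j : ι) (f : MvPolynomial ι ℝ) :
    pderivTwo i j f = MvPolynomial.pderiv i (MvPolynomial.pderiv j f) := rfl

theorem pderivTwo_commute (i j i' j' : ι) :
    Commute (pderivTwo i j) (pderivTwo i' j' : Module.End ℝ (MvPolynomial ι ℝ)) := by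
  refine LinearMap.ext fun f => ?_
  simp only [Module.End.mul_apply, pderivTwo_apply]
  rw [pderiv_pderiv_comm j i', pderiv_pderiv_comm i i', pderiv_pderiv_comm j j',
    pderiv_pderiv_comm i j']

variable [DecidableEq ι]

/-- The matrix `diag(X) + M` over `ℝ[X_i : i ∈ ι]`, with one variable for each diagonal place. -/
def diagVarAdd (M : Matrix ι ι ℝ) : Matrix ι ι (MvPolynomial ι ℝ) :=
  Matrix.diagonal MvPolynomial.X + M.map MvPolynomial.C

theorem diagVarAdd_apply (M : Matrix ι ι ℝ) (i j : ι) :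
    diagVarAdd M i j = (if i = j then MvPolynomial.X i else 0) + MvPolynomial.C (M i j) := by
  simp [diagVarAdd, Matrix.diagonal_apply]

theorem pderiv_diagVarAdd (M : Matrix ι ι ℝ) (p i j : ι) :
    MvPolynomial.pderiv p (diagVarAdd M i j) = if i = p ∧ j = p then 1 else 0 := by
  rw [diagVarAdd_apply, map_add, MvPolynomial.pderiv_C, add_zero]
  by_cases hij : i = j
  · subst hij
    by_cases hp : i = p
    · subst hp; simp
    · simp [hp, MvPolynomial.pderiv_X_of_ne hp]
  · simp only [hij, if_false, map_zero]
    rw [if_neg]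
    rintro ⟨rfl, rfl⟩
    exact hij rfl

variable [Fintype ι]

theorem pderiv_det_diagVarAdd (M : Matrix ι ι ℝ) (p : ι) :
    MvPolynomial.pderiv p (diagVarAdd M).det
      = ((diagVarAdd M).updateRow p (Pi.single p 1)).det := by
  rw [derivation_det_eq_det_updateRow _ _ p fun i hi j => by simp [pderiv_diagVarAdd, hi]]
  congr 2
  ext1 j
  simp [pderiv_diagVarAdd, Pi.single_apply]

theorem pderiv_pderiv_det_diagVarAdd (M : Matrix ι ι ℝ) {p q : ι} (hpq : p ≠ q) :
    MvPolynomial.pderiv p (MvPolynomial.pderiv q (diagVarAdd M).det)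
      = (((diagVarAdd M).updateRow q (Pi.single q 1)).updateRow p (Pi.single p 1)).det := by
  rw [pderiv_det_diagVarAdd, derivation_det_eq_det_updateRow _ _ p]
  · congr 2
    ext1 j
    simp [Matrix.updateRow_ne hpq, pderiv_diagVarAdd, Pi.single_apply]
  · intro i hi j
    by_cases hq : i = q
    · subst hq
      by_cases hj : j = i
      · subst hj; simp
      · simp [hj]
    · simp [Matrix.updateRow_ne hq, pderiv_diagVarAdd, hi]

/-- The determinant of `diag(X) + M` has degree at most one in each variable. -/
theorem pderiv_self_det_diagVarAdd (M : Matrix ι ι ℝ) (p : ι) :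
    MvPolynomial.pderiv p (MvPolynomial.pderiv p (diagVarAdd M).det) = 0 := by
  rw [pderiv_det_diagVarAdd]
  refine derivation_det_eq_zero _ _ fun i j => ?_
  by_cases hq : i = p
  · subst hq
    by_cases hj : j = i
    · subst hj; simp
    · simp [hj]
  · simp [pderiv_diagVarAdd, hq]

theorem pderivTwo_sq_det_diagVarAdd (M : Matrix ι ι ℝ) (p q : ι) :
    pderivTwo p q (pderivTwo p q (diagVarAdd M).det) = 0 := by
  simp only [pderivTwo_apply]
  rw [pderiv_pderiv_comm q p, pderiv_self_det_diagVarAdd, map_zero, map_zero]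

/-- The elementary skew-symmetric matrix `E_pq - E_qp`. -/
def skewUnit (p q : ι) : Matrix ι ι ℝ := Matrix.single p q 1 - Matrix.single q p 1

/-- Along an elementary skew-symmetric direction the determinant of `diag(X) + M` is quadratic,
and its second order term is the mixed derivative of the determinant: the minor without the rows
and columns `p, q`. -/
theorem det_diagVarAdd_add_smul_skewUnit (M : Matrix ι ι ℝ) {p q : ι} (hpq : p ≠ q) :
    ∃ R : MvPolynomial ι ℝ, ∀ u : ℝ, (diagVarAdd (M + u • skewUnit p q)).det
      = (diagVarAdd M).det + u • R + u ^ 2 • pderivTwo p q (diagVarAdd M).det := by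
  set N := diagVarAdd M with hN
  refine ⟨(N.updateRow p (Pi.single q 1)).det - (N.updateRow q (Pi.single p 1)).det, fun u => ?_⟩
  have h1 : diagVarAdd (M + u • skewUnit p q)
      = (N.updateRow q (N q + (-MvPolynomial.C u) • Pi.single p 1)).updateRow p
          (N p + MvPolynomial.C u • Pi.single q 1) := by
    ext1 i j
    by_cases hp : i = p
    · subst hp
      rw [Matrix.updateRow_self]
      by_cases hj : j = q
      · subst hj; simp [hN, diagVarAdd_apply, skewUnit, hpq, Ne.symm hpq]
      · simp [hN, diagVarAdd_apply, skewUnit, Ne.symm hpq, hj, Ne.symm hj]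
    · rw [Matrix.updateRow_ne hp]
      by_cases hq : i = q
      · subst hq
        rw [Matrix.updateRow_self]
        by_cases hj : j = p
        · subst hj; simp [hN, diagVarAdd_apply, skewUnit, hpq, Ne.symm hpq]
        · simp [hN, diagVarAdd_apply, skewUnit, hpq, hj, Ne.symm hj]
      · simp [Matrix.updateRow_ne hq, hN, diagVarAdd_apply, skewUnit, Ne.symm hp, Ne.symm hq]
  -- exchanging the two replaced rows turns the term of order `u²` into the principal minor
  have hswap : ((N.updateRow q (Pi.single p 1)).updateRow p (Pi.single q 1)).det
      = -((N.updateRow q (Pi.single q 1)).updateRow p (Pi.single p 1)).det := by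
    rw [eq_neg_iff_add_eq_zero, add_comm]
    have := Matrix.det_permute (Equiv.swap p q)
      ((N.updateRow q (Pi.single q 1)).updateRow p (Pi.single p 1))
    rw [Equiv.Perm.sign_swap hpq] at this
    rw [show ((N.updateRow q (Pi.single p 1)).updateRow p (Pi.single q 1))
      = ((N.updateRow q (Pi.single q 1)).updateRow p (Pi.single p 1)).submatrix
          (Equiv.swap p q) id from ?_, this]
    · simp
    · ext1 i j
      by_cases hp : i = p
      · subst hp; simp [Matrix.updateRow_ne (Ne.symm hpq)]
      · by_cases hq : i = q
        · subst hq; simp [Matrix.updateRow_ne hp]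
        · simp [Matrix.updateRow_ne hp, Matrix.updateRow_ne hq, Equiv.swap_apply_of_ne_of_ne hp hq]
  rw [h1, Matrix.det_updateRow_add, Matrix.det_updateRow_smul, pderivTwo_apply,
    pderiv_pderiv_det_diagVarAdd M hpq, ← hN]
  have key : ∀ {p q : ι} (w : ι → MvPolynomial ι ℝ), p ≠ q →
      (N.updateRow q w).updateRow p (N p) = N.updateRow q w := by
    intro p q w hpq
    ext1 i j
    by_cases hp : i = p
    · subst hp; simp [Matrix.updateRow_ne hpq]
    · rw [Matrix.updateRow_ne hp]
  rw [key _ hpq, Matrix.updateRow_comm _ (Ne.symm hpq), Matrix.det_updateRow_add,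
    Matrix.det_updateRow_smul, Matrix.det_updateRow_add, Matrix.det_updateRow_smul,
    Matrix.updateRow_comm _ hpq _ (Pi.single p 1), hswap, Matrix.updateRow_eq_self]
  rw [key _ (Ne.symm hpq)]
  simp only [MvPolynomial.smul_eq_C_mul, map_pow]
  ring

/-- Every linear functional of `det (diag(X) + M)` is a measurable function of `M`. -/
theorem measurable_det_diagVarAdd {α : Type*} [MeasurableSpace α] {M : α → Matrix ι ι ℝ}
    (hM : ∀ i j, Measurable fun x => M x i j) (l : MvPolynomial ι ℝ →ₗ[ℝ] ℝ) :
    Measurable fun x => l (diagVarAdd (M x)).det := by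
  have hprod : ∀ (σ : Equiv.Perm ι) (s : Finset ι) (l : MvPolynomial ι ℝ →ₗ[ℝ] ℝ),
      Measurable fun x => l (∏ i ∈ s, diagVarAdd (M x) (σ i) i) := by
    intro σ s
    induction s using Finset.induction_on with
    | empty => intro l; simp
    | insert i s hi ih =>
      intro l
      have : (fun x => l (∏ i ∈ insert i s, diagVarAdd (M x) (σ i) i)) = fun x =>
          (l ∘ₗ LinearMap.mulLeft ℝ (if σ i = i then MvPolynomial.X (σ i) else 0))
            (∏ i ∈ s, diagVarAdd (M x) (σ i) i)
          + M x (σ i) i * l (∏ i ∈ s, diagVarAdd (M x) (σ i) i) := by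
        ext1 x
        rw [Finset.prod_insert hi, diagVarAdd_apply, add_mul, map_add, MvPolynomial.C_mul',
          map_smul]
        rfl
      rw [this]
      exact (ih _).add ((hM _ _).mul (ih _))
  simp_rw [Matrix.det_apply, map_sum, Units.smul_def, map_zsmul, zsmul_eq_mul]
  exact Finset.measurable_fun_sum _ fun σ _ => (hprod σ _ l).const_mul _

end CharMatrix

/-! ### Expectation over a random skew-symmetric perturbation -/

section Expectation

variable {Ω : Type*} [MeasurableSpace Ω] {μ : Measure Ω} [IsProbabilityMeasure μ]

/-- The expected determinant of `diag(X) + M + ∑ c_e U_e (E_pq - E_qp)`, for independent `U_e` with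
mean `0` and variance `1`, is `e^(∑ c_e² ∂_p ∂_q)` of the determinant of `diag(X) + M`. The
expectation is tested against linear functionals `l`. The induction on the set `S` of summands
varies `M`, because the linear coefficient in a new summand is integrated via shifts of `M`. -/
theorem exists_hasExp_expectation {E ι : Type*} [Fintype ι] [DecidableEq ι]
    (p q : E → ι) (hpq : ∀ e, p e ≠ q e) (c : E → ℝ) (U : E → Ω → ℝ)
    (hmeas : ∀ e, Measurable (U e)) (hindep : iIndepFun U μ)
    (hint : ∀ e, Integrable (U e) μ) (hint2 : ∀ e, Integrable (fun ω => U e ω ^ 2) μ)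
    (hmean : ∀ e, ∫ ω, U e ω ∂μ = 0) (hvar : ∀ e, ∫ ω, U e ω ^ 2 ∂μ = 1)
    (S : Finset E) (M : Matrix ι ι ℝ) :
    ∃ r, HasExp (∑ e ∈ S, c e ^ 2 • pderivTwo (p e) (q e)) (diagVarAdd M).det r ∧
      ∀ l : MvPolynomial ι ℝ →ₗ[ℝ] ℝ,
        Integrable (fun ω =>
          l (diagVarAdd (M + ∑ e ∈ S, (c e * U e ω) • skewUnit (p e) (q e))).det) μ ∧
        ∫ ω, l (diagVarAdd (M + ∑ e ∈ S, (c e * U e ω) • skewUnit (p e) (q e))).det ∂μ = l r := by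
  classical
  induction S using Finset.induction_on generalizing M with
  | empty => exact ⟨(diagVarAdd M).det, HasExp.exp_zero _, fun l => by simp⟩
  | insert e S he ih =>
    obtain ⟨r, hr, hE⟩ := ih M
    set D : Module.End ℝ (MvPolynomial ι ℝ) := c e ^ 2 • pderivTwo (p e) (q e) with hD
    have hcomm : Commute (∑ e ∈ S, c e ^ 2 • pderivTwo (p e) (q e)) D :=
      Commute.sum_left _ _ _ fun i _ =>
        ((pderivTwo_commute _ _ _ _).smul_left _).smul_right _
    refine ⟨r + D r, ?_, fun l => ?_⟩
    · rw [Finset.sum_insert he, add_comm]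
      refine hr.add_of_sq_zero hcomm ?_ (hr.map D fun u => (LinearMap.congr_fun hcomm.eq u).symm)
      simp only [LinearMap.smul_apply, map_smul, pderivTwo_sq_det_diagVarAdd, smul_zero]
    choose R hR using fun M : Matrix ι ι ℝ => det_diagVarAdd_add_smul_skewUnit M (hpq e)
    set K := skewUnit (p e) (q e) with hK
    set F : Ω → Matrix ι ι ℝ := fun ω => M + ∑ e ∈ S, (c e * U e ω) • skewUnit (p e) (q e) with hF
    have hFadd : ∀ u : ℝ, (fun ω => F ω + u • K) = fun ω =>
        (M + u • K) + ∑ e ∈ S, (c e * U e ω) • skewUnit (p e) (q e) :=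
      fun u => funext fun ω => add_right_comm _ _ _
    -- the linear coefficient is a difference quotient of determinants with one summand less
    have hRl : ∀ N, l (R N) = (l (diagVarAdd (N + (1 : ℝ) • K)).det
        - l (diagVarAdd (N + (-1 : ℝ) • K)).det) / 2 := by
      intro N
      rw [hR, hR]
      simp only [map_add, map_smul, smul_eq_mul]
      ring
    have hRint : Integrable (fun ω => l (R (F ω))) μ := by
      have hu : ∀ u : ℝ, Integrable (fun ω => l (diagVarAdd (F ω + u • K)).det) μ := by
        intro u
        obtain ⟨_, _, h⟩ := ih (M + u • K)
        have h1 := (h l).1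
        refine h1.congr (Filter.Eventually.of_forall fun ω => ?_)
        simp only [← congrFun (hFadd u) ω]
      simp_rw [hRl]
      exact ((hu 1).sub (hu (-1))).div_const 2
    set G : (S → ℝ) → Matrix ι ι ℝ :=
      fun v => M + ∑ i : S, (c i * v i) • skewUnit (p i) (q i) with hG
    have hFG : ∀ ω, F ω = G fun i => U i ω := by
      intro ω
      simp only [hF, hG]
      rw [Finset.sum_coe_sort S fun i => (c i * U i ω) • skewUnit (p i) (q i)]
    have hGmeas : ∀ (N : Matrix ι ι ℝ) (i j : ι), Measurable fun v => (G v + N) i j := by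
      intro N i j
      simp only [hG, Matrix.add_apply, Matrix.sum_apply, Matrix.smul_apply, smul_eq_mul]
      fun_prop
    have hind : ∀ (f : (S → ℝ) → ℝ), Measurable f → ∀ g : ℝ → ℝ, Measurable g →
        IndepFun (fun ω => g (U e ω)) (fun ω => f fun i => U i ω) μ := by
      intro f hf g hg
      have h := hindep.indepFun_finset {e} S (by simpa using he) hmeas
      exact h.comp (φ := fun v : ({e} : Finset E) → ℝ => g (v ⟨e, by simp⟩))
        (hg.comp (measurable_pi_apply _)) hf
    have hind1 : IndepFun (fun ω => U e ω) (fun ω => l (R (F ω))) μ := by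
      simp_rw [hFG, hRl]
      refine hind (fun v => (l (diagVarAdd (G v + (1 : ℝ) • K)).det
        - l (diagVarAdd (G v + (-1 : ℝ) • K)).det) / 2) ?_ id measurable_id
      exact ((measurable_det_diagVarAdd (hGmeas _) l).sub
        (measurable_det_diagVarAdd (hGmeas _) l)).div_const 2
    -- the quadratic coefficient is the functional `l ∘ D` of a determinant with one summand less
    have hind2 : IndepFun (fun ω => U e ω ^ 2)
        (fun ω => (l ∘ₗ D) (diagVarAdd (F ω)).det) μ := by
      simp_rw [hFG]
      exact hind (fun v => (l ∘ₗ D) (diagVarAdd (G v)).det)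
        (measurable_det_diagVarAdd (fun i j => by simpa using hGmeas 0 i j) _)
        (fun u => u ^ 2) (by fun_prop)
    have hexp : (fun ω => l (diagVarAdd (M + ∑ i ∈ insert e S,
        (c i * U i ω) • skewUnit (p i) (q i))).det) = fun ω =>
        l (diagVarAdd (F ω)).det + c e * (U e ω * l (R (F ω)))
          + U e ω ^ 2 * (l ∘ₗ D) (diagVarAdd (F ω)).det := by
      ext1 ω
      rw [Finset.sum_insert he, add_left_comm, add_comm _ (M + _), hR]
      simp only [hD, LinearMap.comp_apply, LinearMap.smul_apply, map_add, map_smul, smul_eq_mul,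
        hF]
      ring
    obtain ⟨i0, e0⟩ := hE l
    obtain ⟨i2, e2⟩ := hE (l ∘ₗ D)
    change Integrable (fun ω => l (diagVarAdd (F ω)).det) μ at i0
    change ∫ ω, (l ∘ₗ D) (diagVarAdd (F ω)).det ∂μ = _ at e2
    have j1 : Integrable (fun ω => c e * (U e ω * l (R (F ω)))) μ :=
      (hind1.integrable_mul (hint e) hRint).const_mul _
    have j2 : Integrable (fun ω => U e ω ^ 2 * (l ∘ₗ D) (diagVarAdd (F ω)).det) μ :=
      hind2.integrable_mul (hint2 e) i2
    have j01 : Integrable (fun ω => l (diagVarAdd (F ω)).det + c e * (U e ω * l (R (F ω)))) μ :=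
      i0.add j1
    rw [hexp]
    refine ⟨j01.add j2, ?_⟩
    rw [integral_add j01 j2, integral_add i0 j1, integral_const_mul,
      hind1.integral_fun_mul_eq_mul_integral (hint e).1 hRint.1,
      hind2.integral_fun_mul_eq_mul_integral (hint2 e).1 i2.1, hmean, hvar, e0, e2]
    simp

end Expectation

/-! ### Independence and moments of the matrix entries -/

theorem iIndepFun_sumElim {Ω E E' : Type*} [MeasurableSpace Ω] {μ : Measure Ω}
    {U : E → Ω → ℝ} {V : E' → Ω → ℝ} (hU : iIndepFun U μ) (hV : iIndepFun V μ)
    (hUV : IndepFun (fun ω e => U e ω) (fun ω e => V e ω) μ) :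
    iIndepFun (Sum.elim U V) μ := by
  rw [iIndepFun_iff_measure_inter_preimage_eq_mul] at hU hV ⊢
  rw [indepFun_iff_measure_inter_preimage_eq_mul] at hUV
  intro S sets hS
  have hl : ∀ e ∈ S.toLeft, MeasurableSet (sets (Sum.inl e)) := fun e he => hS _ (by simpa using he)
  have hr : ∀ e ∈ S.toRight, MeasurableSet (sets (Sum.inr e)) :=
    fun e he => hS _ (by simpa using he)
  have hset : ⋂ i ∈ S, Sum.elim U V i ⁻¹' sets i
      = (fun ω e => U e ω) ⁻¹' (⋂ e ∈ S.toLeft, (fun v : E → ℝ => v e) ⁻¹' sets (Sum.inl e))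
        ∩ (fun ω e => V e ω) ⁻¹'
          (⋂ e ∈ S.toRight, (fun v : E' → ℝ => v e) ⁻¹' sets (Sum.inr e)) := by
    ext ω
    simp
  rw [hset, hUV]
  · conv_rhs => rw [← S.toLeft_disjSum_toRight, Finset.prod_disjSum]
    have h1 := hU S.toLeft (sets := fun e => sets (Sum.inl e)) hl
    have h2 := hV S.toRight (sets := fun e => sets (Sum.inr e)) hr
    simp only [Sum.elim_inl, Sum.elim_inr]
    rw [← h1, ← h2]
    simp only [Set.preimage_iInter]
    rfl
  · exact Finset.measurableSet_biInter _ fun e he => measurable_pi_apply e (hl e he)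
  · exact Finset.measurableSet_biInter _ fun e he => measurable_pi_apply e (hr e he)

namespace IsStdRandomMatrix

variable {Ω : Type*} [MeasurableSpace Ω] {μ : Measure Ω} {m n : ℕ}
  {X : Ω → Matrix (Fin m) (Fin n) ℝ}

theorem integrable_entry (hX : IsStdRandomMatrix μ X) (i j) : Integrable (fun ω => X ω i j) μ := by
  refine (integrable_norm_iff (hX.measurable_entry i j).aestronglyMeasurable).1 ?_
  simpa using hX.finite_moments i j 1

theorem integrable_entry_sq (hX : IsStdRandomMatrix μ X) (i j) :
    Integrable (fun ω => X ω i j ^ 2) μ := by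
  simpa using hX.finite_moments i j 2

theorem integral_entry (hX : IsStdRandomMatrix μ X) (i j) : ∫ ω, X ω i j ∂μ = 0 := by
  have h := (hX.symmetric i j).integral_eq
  rw [integral_neg] at h
  linarith

theorem integral_entry_sq (hX : IsStdRandomMatrix μ X) (i j) : ∫ ω, X ω i j ^ 2 ∂μ = 1 := by
  have h := hX.variance_eq_one i j
  rw [variance_eq_integral (hX.measurable_entry i j).aemeasurable, hX.integral_entry] at h
  simpa using h

end IsStdRandomMatrix

/-! ### The polynomial `q_{A,B}` as a specialised determinant -/

/-- Chain rule for an identification `c` of the variables. -/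
theorem pderiv_rename_eq_sum {σ τ : Type*} [Fintype σ] [DecidableEq τ] (c : σ → τ) (v : τ)
    (f : MvPolynomial σ ℝ) :
    MvPolynomial.pderiv v (MvPolynomial.rename c f)
      = ∑ i, if c i = v then MvPolynomial.rename c (MvPolynomial.pderiv i f) else 0 := by
  classical
  induction f using MvPolynomial.induction_on with
  | C r => simp
  | add f g hf hg =>
    simp only [map_add, hf, hg, ← Finset.sum_add_distrib]
    refine Finset.sum_congr rfl fun i _ => ?_
    split_ifs <;> simp
  | mul_X f j hf =>
    simp only [map_mul, MvPolynomial.rename_X, MvPolynomial.pderiv_mul, hf, Finset.sum_mul,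
      MvPolynomial.pderiv_X, map_add]
    have hX : (Pi.single v 1 : τ → MvPolynomial τ ℝ) (c j)
        = ∑ i, if c i = v then MvPolynomial.rename c
            ((Pi.single i 1 : σ → MvPolynomial σ ℝ) j) else 0 := by
      rw [Finset.sum_eq_single j]
      · simp [Pi.single_apply]
      · intro i _ hij
        simp [Ne.symm hij]
      · simp
    rw [hX, Finset.mul_sum, ← Finset.sum_add_distrib]
    refine Finset.sum_congr rfl fun i _ => ?_
    split_ifs <;> simp

section Blocks

variable {s t k : ℕ}

/-- The skew-symmetric matrix with blocks `[[0, Aᵀ, Bᵀ], [-A, 0, 0], [-B, 0, 0]]`. -/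
def skewBlock (A : Matrix (Fin s) (Fin k) ℝ) (B : Matrix (Fin t) (Fin k) ℝ) :
    Matrix (Fin k ⊕ (Fin s ⊕ Fin t)) (Fin k ⊕ (Fin s ⊕ Fin t)) ℝ :=
  Matrix.fromBlocks 0 (Matrix.fromCols A.transpose B.transpose) (-Matrix.fromRows A B) 0

/-- The places of the entries of a pair of matrices of sizes `s × k` and `t × k`. -/
abbrev EntryPair (s t k : ℕ) : Type := (Fin s × Fin k) ⊕ (Fin t × Fin k)

/-- The column index of an entry of `A` or `B`, as an index of `skewBlock A B`. -/
def entryCol : EntryPair s t k → Fin k ⊕ (Fin s ⊕ Fin t) :=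
  Sum.elim (fun e => Sum.inl e.2) (fun e => Sum.inl e.2)

/-- The row index of an entry of `A` or `B`, as an index of `skewBlock A B`. -/
def entryRow : EntryPair s t k → Fin k ⊕ (Fin s ⊕ Fin t) :=
  Sum.elim (fun e => Sum.inr (Sum.inl e.1)) (fun e => Sum.inr (Sum.inr e.1))

theorem skewBlock_add_smul (A X : Matrix (Fin s) (Fin k) ℝ) (B Y : Matrix (Fin t) (Fin k) ℝ)
    (a b : ℝ) :
    skewBlock (A + a • X) (B + b • Y) = skewBlock A B
      + ∑ e : EntryPair s t k, (Sum.elim (fun _ => a) (fun _ => b) e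
          * Sum.elim (fun e => X e.1 e.2) (fun e => Y e.1 e.2) e)
            • skewUnit (entryCol e) (entryRow e) := by
  ext i j
  rw [Matrix.add_apply, Matrix.sum_apply, Fintype.sum_sum_type, Fintype.sum_prod_type,
    Fintype.sum_prod_type]
  rcases i with i | i | i <;> rcases j with j | j | j <;>
    simp [skewBlock, skewUnit, entryCol, entryRow, Matrix.single_apply, ite_and,
      add_comm]

/-- The specialisation of the variables: `x` for the indices in `Fin k`, `y` for those in `Fin s`
and `z` for those in `Fin t`. -/
def blockVar : Fin k ⊕ (Fin s ⊕ Fin t) → Fin 3 :=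
  Sum.elim (fun _ => 0) (Sum.elim (fun _ => 1) (fun _ => 2))

/-- Schur complement formula for `det [[x, Aᵀ, Bᵀ], [-A, y, 0], [-B, 0, z]]`. -/
theorem rename_det_skewBlock (A : Matrix (Fin s) (Fin k) ℝ) (B : Matrix (Fin t) (Fin k) ℝ) :
    MvPolynomial.rename blockVar (diagVarAdd (skewBlock A B)).det = transCharPoly A B := by
  -- the values for nonzero `y` and `z` determine the polynomial
  refine MvPolynomial.funext_set (fun _ : Fin 3 => ({0}ᶜ : Set ℝ))
    (fun _ => (Set.finite_singleton _).infinite_compl) fun v hv => ?_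
  have hv0 : ∀ i, v i ≠ 0 := fun i => by simpa using hv i
  obtain ⟨x, y, z, rfl⟩ : ∃ x y z, v = ![x, y, z] :=
    ⟨v 0, v 1, v 2, by ext i; fin_cases i <;> rfl⟩
  have hy : y ≠ 0 := hv0 1
  have hz : z ≠ 0 := hv0 2
  rw [eval_transCharPoly A B x y z hy hz, MvPolynomial.eval_rename, RingHom.map_det]
  set d : Fin s ⊕ Fin t → ℝ := Sum.elim (fun _ => y) (fun _ => z) with hd
  have hd0 : ∀ i, d i ≠ 0 := by
    rintro (i | i)
    exacts [hy, hz]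
  have hmat : (MvPolynomial.eval (![x, y, z] ∘ blockVar)).mapMatrix (diagVarAdd (skewBlock A B))
      = Matrix.fromBlocks (x • 1) (Matrix.fromCols A.transpose B.transpose)
          (-Matrix.fromRows A B) (Matrix.diagonal d) := by
    ext i j
    rcases i with i | i | i <;> rcases j with j | j | j <;>
      simp [diagVarAdd_apply, skewBlock, blockVar, hd, Matrix.diagonal_apply, Matrix.one_apply,
        apply_ite] <;>
      split_ifs <;> tauto
  let _ : Invertible (Matrix.diagonal d) :=
    invertibleOfRightInverse _ (Matrix.diagonal fun i => (d i)⁻¹) (by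
      rw [Matrix.diagonal_mul_diagonal, ← Matrix.diagonal_one]
      congr 1
      ext i
      exact mul_inv_cancel₀ (hd0 i))
  have hinv : ⅟(Matrix.diagonal d) = Matrix.diagonal fun i => (d i)⁻¹ := rfl
  rw [hmat, Matrix.det_fromBlocks₂₂, hinv, Matrix.det_diagonal, Fintype.prod_sum_type]
  congr 1
  · simp [hd]
  · congr 1
    ext i j
    rw [Matrix.sub_apply, Matrix.mul_apply]
    simp only [Matrix.mul_diagonal]
    simp only [Matrix.mul_apply, Fintype.sum_sum_type, hd, Matrix.add_apply, Matrix.smul_apply,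
      Matrix.fromCols_apply_inl, Matrix.fromCols_apply_inr, Matrix.neg_apply, Sum.elim_inl,
      Sum.elim_inr, Matrix.fromRows_apply_inl, Matrix.fromRows_apply_inr, Matrix.transpose_apply,
      mul_neg, Finset.sum_neg_distrib, smul_eq_mul, mul_right_comm _ _ (A _ j),
      mul_right_comm _ _ (B _ j), ← Finset.sum_mul]
    ring

/-- After identification of the variables within each block, the sum of all `∂_p ∂_q`, weighted by
`a²` for the entries of `A` and by `b²` for those of `B`, is `a² ∂_x ∂_y + b² ∂_x ∂_z`. -/
theorem rename_sum_pderivTwo (a b : ℝ) (f : MvPolynomial (Fin k ⊕ (Fin s ⊕ Fin t)) ℝ) :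
    MvPolynomial.rename blockVar ((∑ e : EntryPair s t k,
        (Sum.elim (fun _ => a) (fun _ => b) e : ℝ) ^ 2 • pderivTwo (entryCol e) (entryRow e)) f)
      = mixedDiffOp (a ^ 2) (b ^ 2) (MvPolynomial.rename blockVar f) := by
  simp only [mixedDiffOp, LinearMap.add_apply, LinearMap.smul_apply, LinearMap.comp_apply,
    Derivation.coeFn_coe, pderiv_rename_eq_sum, Fintype.sum_sum_type,
    Fintype.sum_prod_type, LinearMap.sum_apply, pderivTwo_apply]
  simp [blockVar, entryCol, entryRow, pderiv_rename_eq_sum, Finset.smul_sum]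

end Blocks

end

theorem mainTheorem1 {Ω : Type*} [MeasurableSpace Ω] (μ : Measure Ω) [IsProbabilityMeasure μ]
    (s t k : ℕ) (A : Matrix (Fin s) (Fin k) ℝ) (B : Matrix (Fin t) (Fin k) ℝ) (a b : ℝ)
    (X : Ω → Matrix (Fin s) (Fin k) ℝ) (Y : Ω → Matrix (Fin t) (Fin k) ℝ)
    (hX : IsStdRandomMatrix μ X) (hY : IsStdRandomMatrix μ Y)
    (hXY : IndepFun (fun ω (e : Fin s × Fin k) => X ω e.1 e.2)
      (fun ω (e : Fin t × Fin k) => Y ω e.1 e.2) μ) :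
    HasPolyExpectation μ (fun ω => transCharPoly (A + a • X ω) (B + b • Y ω))
      (expApply (mixedDiffOp (a ^ 2) (b ^ 2)) (transCharPoly A B)) := by
  set c : EntryPair s t k → ℝ := Sum.elim (fun _ => a) (fun _ => b) with hc
  set U : EntryPair s t k → Ω → ℝ :=
    Sum.elim (fun e ω => X ω e.1 e.2) (fun e ω => Y ω e.1 e.2) with hU
  obtain ⟨r, hr, hE⟩ := exists_hasExp_expectation (μ := μ) entryCol entryRow
    (by rintro (e | e) <;> simp [entryCol, entryRow]) c U
    (by rintro (e | e); exacts [hX.measurable_entry _ _, hY.measurable_entry _ _])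
    (iIndepFun_sumElim hX.indep hY.indep hXY)
    (by rintro (e | e); exacts [hX.integrable_entry _ _, hY.integrable_entry _ _])
    (by rintro (e | e); exacts [hX.integrable_entry_sq _ _, hY.integrable_entry_sq _ _])
    (by rintro (e | e); exacts [hX.integral_entry _ _, hY.integral_entry _ _])
    (by rintro (e | e); exacts [hX.integral_entry_sq _ _, hY.integral_entry_sq _ _])
    Finset.univ (skewBlock A B)
  have hexp := (hr.map (MvPolynomial.rename blockVar).toLinearMap
    fun f => rename_sum_pderivTwo a b f).expApply_eq
  simp only [AlgHom.toLinearMap_apply, rename_det_skewBlock] at hexp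
  intro m
  have hcoeff : ∀ ω, (transCharPoly (A + a • X ω) (B + b • Y ω)).coeff m
      = (MvPolynomial.lcoeff ℝ m ∘ₗ (MvPolynomial.rename blockVar).toLinearMap)
        (diagVarAdd (skewBlock A B
          + ∑ e, (c e * U e ω) • skewUnit (entryCol e) (entryRow e))).det := by
    intro ω
    have hsum : ∀ e, U e ω = Sum.elim (fun e => X ω e.1 e.2) (fun e => Y ω e.1 e.2) e := by
      rintro (e | e) <;> rfl
    simp_rw [hsum]
    rw [← rename_det_skewBlock, skewBlock_add_smul]
    rfl
  simp_rw [hcoeff, hexp]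
  exact hE _
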